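/- **Setting.** Let $X\neq\emptyset$, let $k:X\times X\to\mathbb R$ be a kernel with reproducing kernel Hilbert space $H_k$, and let $d_k(x,x')=\|k(\cdot,x)-k(\cdot,x')\|_k$. Assume that the (semi)metric space $(X,d_k)$ is compact and that $k$ is bounded, Borel measurable and characteristic, i.e. the kernel mean embedding $\Pi_k(\mu)=\int k(\cdot,x)\,d\mu(x)\in H_k$ is injective on the set $\mathcal P(X)$ of Borel probability measures. Put $\gamma_k(\mu,\nu)=\|\Pi_k(\mu)-\Pi_k(\nu)\|_k$ (the MMD), and for $\vec x\in X^M$, $M\ge 1$, let $\hat\mu[\vec x]=\frac1M\sum_{i=1}^M\delta_{x_i}$. Let $H$ be a real Hilbert space and $U\subseteq H$ compact and convex. For every $M\ge1$ let $f_M:X^M\times U\to X^M$ and $\ell_M:X^M\times U\to\mathbb R$ be such that, for constants $L_f,L_\ell\ge0$ independent of $M$, for all permutations $\sigma$ of $\{1,\dots,M\}$ and all $\vec x,\vec x'\in X^M$, $u,u'\in U$: - $f_M(\sigma\vec x,u)=\sigma f_M(\vec x,u)$ and $\gamma_k(\hat\mu[f_M(\vec x,u)],\hat\mu[f_M(\vec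 x',u')])\le L_f\,\|(\Pi_k(\hat\mu[\vec x]),u)-(\Pi_k(\hat\mu[\vec x']),u')\|_{H_k\times H}$ (Hilbert product norm); - $\ell_M(\sigma\vec x,u)=\ell_M(\vec x,u)$, the $\ell_M$ are bounded uniformly in $M$, and $|\ell_M(\vec x,u)-\ell_M(\vec x',u')|\le L_\ell(\gamma_k(\hat\mu[\vec x],\hat\mu[\vec x'])+\|u-u'\|_H)$. For a strictly increasing sequence $(N_p)_p$ of positive integers, we say that $f:\mathcal P(X)\times U\to\mathcal P(X)$ and $\ell:\mathcal P(X)\times U\to\mathbb R$ are the *mean field limits of $(f_M)$ and $(\ell_M)$ along $(N_p)$* if they are $L_f$-, respectively $L_\ell$-Lipschitz, i.e. $\gamma_k(f(\mu,u),f(\nu,u'))\le L_f\|(\Pi_k(\mu),u)-(\Pi_k(\nu),u')\|_{H_k\times H}$ and $|\ell(\mu,u)-\ell(\nu,u')|\le L_\ell(\gamma_k(\mu,\nu)+\|u-u'\|_H)$, and, as $p\to\infty$, $$\sup_{\vec x\in X^{N_p},u\in U}\gamma_k(\hat\mu[f_{N_p}(\vec x,u)],f(\hat\mu[\vec x],u))\to0,\qquad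 \sup_{\vec x\in X^{N_p},u\in U}|\ell_{N_p}(\vec x,u)-\ell(\hat\mu[\vec x],u)|\to0 .$$ **Theorem 3.** Such a sequence $(N_p)$ and such mean field limits $f,\ell$ exist. Moreover, let $(N_p)$, $f$, $\ell$ be any such sequence and limits. For every $M$ in $\{N_p\}$ let $\tilde V_M:X^M\to\mathbb R_{\ge0}$ and $\kappa_M:X^M\to U$ be permutation invariant with $$|\tilde V_M(\vec x)-\tilde V_M(\vec x')|\le L_{\tilde V}\,\gamma_k(\hat\mu[\vec x],\hat\mu[\vec x']),\qquad \|\kappa_M(\vec x)-\kappa_M(\vec x')\|_H\le L_\kappa\,\gamma_k(\hat\mu[\vec x],\hat\mu[\vec x'])$$ for all $\vec x,\vec x'\in X^M$, with constants $L_{\tilde V},L_\kappa\ge0$ independent of $M$, and suppose that for some $\alpha\in(0,1]$, all $M\in\{N_p\}$ and all $\vec x\in X^M$ $$\tilde V_M(\vec x)\ \ge\ \tilde V_M\big(f_M(\vec x,\kappa_M(\vec x))\big)+\alpha\,\ell_M(\vec x,\kappa_M(\vec x)).$$ Then there exist a subsequence $(M_m)_m$ of $(N_p)_p$, a function $\tilde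 V:\mathcal P(X)\to\mathbb R_{\ge0}$ that is $L_{\tilde V}$-Lipschitz with respect to $\gamma_k$, and a map $\kappa:\mathcal P(X)\to U$ that is $L_\kappa$-Lipschitz with respect to $\gamma_k$, such that $\sup_{\vec x\in X^{M_m}}\|\kappa_{M_m}(\vec x)-\kappa(\hat\mu[\vec x])\|_H\to0$ and, for all $\mu\in\mathcal P(X)$, $$\tilde V(\mu)\ \ge\ \tilde V\big(f(\mu,\kappa(\mu))\big)+\alpha\,\ell(\mu,\kappa(\mu)).$$ If in addition the $\tilde V_M$, $M\in\{N_p\}$, are bounded uniformly in $M$, then $\tilde V$ can be chosen (with the same subsequence and the same $\kappa$) such that also $\sup_{\vec x\in X^{M_m}}|\tilde V_{M_m}(\vec x)-\tilde V(\hat\mu[\vec x])|\to0$. -/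

import Mathlib

open MeasureTheory Filter
open scoped NNReal ENNReal Topology InnerProductSpace

noncomputable section

namespace MeanField

section Kernel

variable {X : Type*} (Hk : Type*) [NormedAddCommGroup Hk] [InnerProductSpace ℝ Hk]
  [CompleteSpace Hk] [RKHS ℝ Hk X ℝ]

/-- The element `k(·, x)` of the reproducing kernel Hilbert space `Hk`, i.e. the representer of
point evaluation at `x`. -/
def feature (x : X) : Hk := RKHS.kerFun Hk x (1 : ℝ)

/-- The reproducing property of `feature`. -/
theorem inner_feature (g : Hk) (x : X) : ⟪g, feature Hk x⟫_ℝ = g x := by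
  simp [feature]

/-- `k` is the reproducing kernel of `Hk`; then `Hk` is, up to isometry, the unique reproducing
kernel Hilbert space `H_k` of the kernel `k`. -/
def IsReproducingKernel (k : X → X → ℝ) : Prop :=
  ∀ x y : X, (feature Hk y : Hk) x = k x y

/-- The kernel (semi)metric `d_k(x, x') = ‖k(·, x) - k(·, x')‖_k`. -/
def kernelDist (x x' : X) : ℝ := ‖feature Hk x - feature Hk x'‖

/-- The kernel mean embedding `Π_k(μ) = ∫ k(·, x) dμ(x)`, a Bochner integral in `Hk`. -/
def kme [MeasurableSpace X] (μ : ProbabilityMeasure X) : Hk :=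
  ∫ x, feature Hk x ∂(μ : Measure X)

/-- The maximum mean discrepancy `γ_k(μ, ν) = ‖Π_k(μ) - Π_k(ν)‖_k`. -/
def mmd [MeasurableSpace X] (μ ν : ProbabilityMeasure X) : ℝ :=
  ‖kme Hk μ - kme Hk ν‖

/-- Standing assumption on the space and the kernel: `k` is the kernel of `Hk`, the (semi)metric of
`X` is the kernel (semi)metric, `(X, d_k)` is compact, and `k` is bounded, Borel measurable and
characteristic. -/
structure SpaceAssumption [PseudoMetricSpace X] [MeasurableSpace X] (k : X → X → ℝ) : Prop where
  reproducing : IsReproducingKernel Hk k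
  dist_eq : ∀ x x' : X, dist x x' = kernelDist Hk x x'
  compact : CompactSpace X
  bounded : ∃ C : ℝ, ∀ x x' : X, |k x x'| ≤ C
  measurable : Measurable (Function.uncurry k)
  characteristic : Function.Injective (kme Hk : ProbabilityMeasure X → Hk)

end Kernel

/-- The empirical measure `(1/M) ∑ δ_{x_i}` of a tuple `x ∈ X^M`, `M ≥ 1`. -/
def empirical {X : Type*} [MeasurableSpace X] {M : ℕ+}
    (x : Fin M → X) : ProbabilityMeasure X :=
  ⟨((M : ℕ) : ℝ≥0∞)⁻¹ • ∑ i, Measure.dirac (x i), ⟨by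
    have h0 : ((M : ℕ) : ℝ≥0∞) ≠ 0 := by exact_mod_cast M.ne_zero
    simp [ENNReal.inv_mul_cancel h0 (ENNReal.natCast_ne_top _)]⟩⟩

section Systems

variable {X : Type*} [PseudoMetricSpace X] [MeasurableSpace X]
  (Hk : Type*) [NormedAddCommGroup Hk] [InnerProductSpace ℝ Hk] [CompleteSpace Hk]
  [RKHS ℝ Hk X ℝ]
  {H : Type*} [NormedAddCommGroup H] [InnerProductSpace ℝ H] (U : Set H)

/-- The distance `‖(Π_k(μ), u) - (Π_k(ν), u')‖` in the product Hilbert space `H_k × H`. -/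
def prodDist (μ ν : ProbabilityMeasure X) (u u' : H) : ℝ :=
  ‖(WithLp.toLp 2 (kme Hk μ, u) : WithLp 2 (Hk × H)) - WithLp.toLp 2 (kme Hk ν, u')‖

/-- Assumption on the transition functions `f^{[M]} : X^M × U → X^M`: permutation equivariance in
the state, and Lipschitz continuity with a constant `Lf` that does not depend on `M`. -/
structure SystemAssumption (f : ∀ M : ℕ+, (Fin M → X) → U → (Fin M → X)) (Lf : ℝ) : Prop where
  equivariant : ∀ (M : ℕ+) (x : Fin M → X) (σ : Equiv.Perm (Fin M)) (u : U),
    f M (x ∘ σ) u = f M x u ∘ σ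
  lipschitz : ∀ (M : ℕ+) (x x' : Fin M → X) (u u' : U),
    mmd Hk (empirical (f M x u)) (empirical (f M x' u')) ≤
      Lf * prodDist Hk (empirical x) (empirical x') (u : H) (u' : H)

/-- Assumption on the stage costs `ℓ^{[M]} : X^M × U → ℝ`: permutation invariance in the state,
uniform boundedness, and Lipschitz continuity with a constant `Ll` that does not depend
on `M`. -/
structure CostAssumption (l : ∀ M : ℕ+, (Fin M → X) → U → ℝ) (Ll : ℝ) : Prop where
  invariant : ∀ (M : ℕ+) (x : Fin M → X) (σ : Equiv.Perm (Fin M)) (u : U),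
    l M (x ∘ σ) u = l M x u
  bounded : ∃ B : ℝ, ∀ (M : ℕ+) (x : Fin M → X) (u : U), |l M x u| ≤ B
  lipschitz : ∀ (M : ℕ+) (x x' : Fin M → X) (u u' : U),
    |l M x u - l M x' u'| ≤ Ll * (mmd Hk (empirical x) (empirical x') + ‖(u : H) - (u' : H)‖)

/-- `F : P(X) × U → P(X)` is the mean field limit of the transition functions along the index
sequence `N`: it is `Lf`-Lipschitz and
`sup_{x ∈ X^{N p}, u ∈ U} γ_k(μ̂[f^{[N p]}(x, u)], F(μ̂[x], u)) → 0` as `p → ∞`. -/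
structure IsLimitDynamics (f : ∀ M : ℕ+, (Fin M → X) → U → (Fin M → X)) (Lf : ℝ) (N : ℕ → ℕ+)
    (F : ProbabilityMeasure X → U → ProbabilityMeasure X) : Prop where
  lipschitz : ∀ (μ ν : ProbabilityMeasure X) (u u' : U),
    mmd Hk (F μ u) (F ν u') ≤ Lf * prodDist Hk μ ν (u : H) (u' : H)
  tendsto : ∀ ε > 0, ∀ᶠ p in atTop, ∀ (x : Fin (N p) → X) (u : U),
    mmd Hk (empirical (f (N p) x u)) (F (empirical x) u) ≤ ε

/-- `l∞ : P(X) × U → ℝ` is the mean field limit of the stage costs along the index sequence `N`: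
it is `Ll`-Lipschitz and `sup_{x ∈ X^{N p}, u ∈ U} |ℓ^{[N p]}(x, u) - l∞(μ̂[x], u)| → 0` as
`p → ∞`. -/
structure IsLimitCost (l : ∀ M : ℕ+, (Fin M → X) → U → ℝ) (Ll : ℝ) (N : ℕ → ℕ+)
    (linf : ProbabilityMeasure X → U → ℝ) : Prop where
  lipschitz : ∀ (μ ν : ProbabilityMeasure X) (u u' : U),
    |linf μ u - linf ν u'| ≤ Ll * (mmd Hk μ ν + ‖(u : H) - (u' : H)‖)
  tendsto : ∀ ε > 0, ∀ᶠ p in atTop, ∀ (x : Fin (N p) → X) (u : U),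
    |l (N p) x u - linf (empirical x) u| ≤ ε

end Systems

end MeanField

end

/-!
Empirical measures are dense in `P(X)` for `γ_k`: choosing the atoms one after another, each with
nonpositive inner product with the centred sum so far, gives `‖Π_k(μ̂[x]) - Π_k(μ)‖ ≤ 2C / √M`.
Moreover `Π_k(P(X))` is compact. Along a nonprincipal ultrafilter, equi-Lipschitz functions of
empirical measures with values in a compact set therefore have a Lipschitz limit on `P(X)`, and by
total boundedness the convergence is uniform. Evaluating the dynamic programming inequality along
empirical measures that converge to `μ` yields the inequality for the limits. Uniform convergence
along the ultrafilter gives uniform convergence along a subsequence. Since `P(X)` is bounded, value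
functions that are not uniformly bounded become so after subtracting a constant for each `M`, which
leaves the dynamic programming inequality unchanged.
-/

namespace MeanField

open Set

section LipschitzLimit

variable {ι Z E F : Type*} {A : ι → Type*} [PseudoMetricSpace E] [PseudoMetricSpace F]
  {v : Filter ι} {Φ : Z → E} {e : ∀ i, A i → Z} {L : ℝ} {g : ∀ i, A i → F} {G : Z → F}

/-- `G : Z → F` is the uniform limit along `v` of the functions `g i : A i → F`, where a point
`a : A i` stands for the point `e i a` of `Z`, and `G` is `L`-Lipschitz. The semimetric on `Z` is
the one pulled back along `Φ`. -/
structure IsLipschitzLimit (v : Filter ι) (Φ : Z → E) (e : ∀ i, A i → Z) (L : ℝ)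
    (g : ∀ i, A i → F) (G : Z → F) : Prop where
  lipschitz : ∀ z z', dist (G z) (G z') ≤ L * dist (Φ z) (Φ z')
  tendsto : ∀ ε > 0, ∀ᶠ i in v, ∀ a, dist (g i a) (G (e i a)) ≤ ε

/-- Every point of `Z`, in the semimetric pulled back along `Φ`, is a limit along `v` of points
`e i (a i)`. -/
def AsymptoticallyDense (v : Filter ι) (Φ : Z → E) (e : ∀ i, A i → Z) : Prop :=
  ∀ z, ∃ a : ∀ i, A i, Tendsto (fun i ↦ Φ (e i (a i))) v (𝓝 (Φ z))

theorem IsLipschitzLimit.mono (hG : IsLipschitzLimit v Φ e L g G) {w : Filter ι} (hw : w ≤ v) :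
    IsLipschitzLimit w Φ e L g G :=
  ⟨hG.lipschitz, fun ε hε ↦ hw (hG.tendsto ε hε)⟩

theorem IsLipschitzLimit.tendsto_apply (hG : IsLipschitzLimit v Φ e L g G) {a : ∀ i, A i} {z : Z}
    (ha : Tendsto (fun i ↦ Φ (e i (a i))) v (𝓝 (Φ z))) :
    Tendsto (fun i ↦ g i (a i)) v (𝓝 (G z)) := by
  have hunif : Tendsto (fun i ↦ dist (g i (a i)) (G (e i (a i)))) v (𝓝 0) :=
    Metric.nhds_basis_closedBall.tendsto_right_iff.2 fun ε hε ↦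
      (hG.tendsto ε hε).mono fun i hi ↦ by simpa using hi (a i)
  have hlip : Tendsto (fun i ↦ L * dist (Φ (e i (a i))) (Φ z)) v (𝓝 0) := by
    simpa using (tendsto_iff_dist_tendsto_zero.1 ha).const_mul L
  refine tendsto_iff_dist_tendsto_zero.2
    (squeeze_zero (fun _ ↦ dist_nonneg) (fun i ↦ ?_) (by simpa using hunif.add hlip))
  exact (dist_triangle _ (G (e i (a i))) _).trans (add_le_add_right (hG.lipschitz _ _) _)

theorem eventually_forall_dist_le_of_dist_lt (hL : 0 ≤ L)
    (hg : ∀ i a a', dist (g i a) (g i a') ≤ L * dist (Φ (e i a)) (Φ (e i a')))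
    (hG : ∀ z z', dist (G z) (G z') ≤ L * dist (Φ z) (Φ z')) {a : ∀ i, A i} {z : Z}
    (ha : Tendsto (fun i ↦ Φ (e i (a i))) v (𝓝 (Φ z)))
    (hga : Tendsto (fun i ↦ g i (a i)) v (𝓝 (G z))) {ε : ℝ} (hε : 0 < ε) :
    ∀ᶠ i in v, ∀ b, dist (Φ (e i b)) (Φ z) < ε → dist (g i b) (G (e i b)) ≤ (3 * L + 1) * ε := by
  filter_upwards [Metric.tendsto_nhds.1 ha ε hε, Metric.tendsto_nhds.1 hga ε hε] with i hi hgi b hb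
  calc dist (g i b) (G (e i b))
      ≤ dist (g i b) (g i (a i)) + dist (g i (a i)) (G z) + dist (G z) (G (e i b)) :=
        dist_triangle4 _ _ _ _
    _ ≤ L * (ε + ε) + ε + L * ε := by
        gcongr
        · refine (hg i b (a i)).trans (mul_le_mul_of_nonneg_left ?_ hL)
          exact (dist_triangle_right _ _ (Φ z)).trans (add_le_add hb.le hi.le)
        · refine (hG z (e i b)).trans (mul_le_mul_of_nonneg_left ?_ hL)
          exact (dist_comm _ _).trans_le hb.le
    _ = (3 * L + 1) * ε := by ring

theorem isLipschitzLimit_of_tendsto [NeBot v] (hΦ : TotallyBounded (range Φ)) (hL : 0 ≤ L)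
    (hg : ∀ i a a', dist (g i a) (g i a') ≤ L * dist (Φ (e i a)) (Φ (e i a')))
    (hG : ∀ z, ∃ a : ∀ i, A i, Tendsto (fun i ↦ Φ (e i (a i))) v (𝓝 (Φ z)) ∧
      Tendsto (fun i ↦ g i (a i)) v (𝓝 (G z))) :
    IsLipschitzLimit v Φ e L g G := by
  choose a ha hga using hG
  have hGL : ∀ z z', dist (G z) (G z') ≤ L * dist (Φ z) (Φ z') := fun z z' ↦
    le_of_tendsto_of_tendsto' ((hga z).dist (hga z')) (((ha z).dist (ha z')).const_mul L)
      fun i ↦ hg i _ _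
  refine ⟨hGL, fun ε hε ↦ ?_⟩
  set η := ε / (3 * L + 1)
  have hη : 0 < η := by positivity
  obtain ⟨t, htΦ, ht, hcover⟩ := Metric.finite_approx_of_totallyBounded hΦ η hη
  have hnear : ∀ᶠ i in v, ∀ y ∈ t, ∀ b, dist (Φ (e i b)) y < η → dist (g i b) (G (e i b)) ≤ ε := by
    refine ht.eventually_all.2 fun y hy ↦ ?_
    obtain ⟨z, rfl⟩ := htΦ hy
    simpa only [η, mul_div_cancel₀ ε (by positivity : 3 * L + 1 ≠ 0)] using
      eventually_forall_dist_le_of_dist_lt hL hg hGL (ha z) (hga z) hη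
  filter_upwards [hnear] with i hi b
  obtain ⟨y, hy, hb⟩ := mem_iUnion₂.1 (hcover (mem_range_self (e i b)))
  exact hi y hy b hb

theorem exists_isLipschitzLimit {v : Ultrafilter ι} (hdense : AsymptoticallyDense v Φ e)
    (hΦ : TotallyBounded (range Φ)) {K : Set F} (hK : IsCompact K) (hL : 0 ≤ L)
    (hgK : ∀ i a, g i a ∈ K)
    (hg : ∀ i a a', dist (g i a) (g i a') ≤ L * dist (Φ (e i a)) (Φ (e i a'))) :
    ∃ G : Z → F, (∀ z, G z ∈ K) ∧ IsLipschitzLimit v Φ e L g G := by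
  choose a ha using hdense
  choose G hGK hG using fun z ↦ hK.ultrafilter_le_nhds (Ultrafilter.map (fun i ↦ g i (a z i)) v)
    (tendsto_principal.2 (Eventually.of_forall fun i ↦ hgK i (a z i)))
  exact ⟨G, hGK, isLipschitzLimit_of_tendsto hΦ hL hg fun z ↦ ⟨a z, ha z, hG z⟩⟩

theorem exists_strictMono_forall_eventually {Q : ℝ → ℕ → Prop} (hQ : ∀ p, Monotone (Q · p))
    (h : ∀ ε > 0, ∃ᶠ p in atTop, Q ε p) :
    ∃ m : ℕ → ℕ, StrictMono m ∧ ∀ ε > 0, ∀ᶠ j in atTop, Q ε (m j) := by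
  obtain ⟨m, hm, hmQ⟩ := extraction_forall_of_frequently fun n : ℕ ↦
    h (1 / ((n : ℝ) + 1)) Nat.one_div_pos_of_nat
  refine ⟨m, hm, fun ε hε ↦ ?_⟩
  filter_upwards [tendsto_one_div_add_atTop_nhds_zero_nat.eventually_le_const hε] with j hj
  exact hQ (m j) hj (hmQ j)

theorem exists_strictMono_isLipschitzLimit {E' F' Z' : Type*} [PseudoMetricSpace E']
    [PseudoMetricSpace F'] {A A' : ℕ → Type*} {v : Filter ℕ} [NeBot v] (hv : v ≤ atTop)
    {e : ∀ p, A p → Z} {g : ∀ p, A p → F} (hG : IsLipschitzLimit v Φ e L g G)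
    {Φ' : Z' → E'} {e' : ∀ p, A' p → Z'} {L' : ℝ} {g' : ∀ p, A' p → F'} {G' : Z' → F'}
    (hG' : IsLipschitzLimit v Φ' e' L' g' G') :
    ∃ m : ℕ → ℕ, StrictMono m ∧
      IsLipschitzLimit atTop Φ (fun j ↦ e (m j)) L (fun j ↦ g (m j)) G ∧
      IsLipschitzLimit atTop Φ' (fun j ↦ e' (m j)) L' (fun j ↦ g' (m j)) G' := by
  obtain ⟨m, hm, hlim⟩ := exists_strictMono_forall_eventually
    (Q := fun ε p ↦ (∀ a, dist (g p a) (G (e p a)) ≤ ε) ∧ ∀ a, dist (g' p a) (G' (e' p a)) ≤ ε)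
    (fun p _ _ hle ↦ And.imp (fun h a ↦ (h a).trans hle) (fun h a ↦ (h a).trans hle))
    (fun ε hε ↦ ((hG.tendsto ε hε).and (hG'.tendsto ε hε)).frequently.filter_mono hv)
  exact ⟨m, hm, ⟨hG.lipschitz, fun ε hε ↦ (hlim ε hε).mono fun _ ↦ And.left⟩,
    ⟨hG'.lipschitz, fun ε hε ↦ (hlim ε hε).mono fun _ ↦ And.right⟩⟩

theorem exists_eq_add_const_of_dist_le {f : ∀ i, A i → ℝ≥0} {D : ℝ}
    (hD : ∀ i a a', dist (f i a) (f i a') ≤ D) :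
    ∃ (w : ∀ i, A i → ℝ≥0) (c : ι → ℝ≥0) (B : ℝ≥0), (∀ i a, f i a = w i a + c i) ∧
      (∀ i a, w i a ≤ B) ∧ ((∃ C : ℝ, ∀ i a, (f i a : ℝ) ≤ C) → w = f) := by
  by_cases hf : ∃ C : ℝ, ∀ i a, (f i a : ℝ) ≤ C
  · obtain ⟨C, hC⟩ := hf
    exact ⟨f, 0, C.toNNReal, by simp, fun i a ↦ NNReal.le_toNNReal_of_coe_le (hC i a), fun _ ↦ rfl⟩
  · refine ⟨fun i a ↦ f i a - ⨅ a', f i a', fun i ↦ ⨅ a', f i a', D.toNNReal, fun i a ↦ ?_,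
      fun i a ↦ ?_, fun h ↦ absurd h hf⟩
    · exact (tsub_add_cancel_of_le (ciInf_le (OrderBot.bddBelow _) a)).symm
    · have : Nonempty (A i) := ⟨a⟩
      refine tsub_le_iff_tsub_le.1 (le_ciInf fun a' ↦ tsub_le_iff_right.2 ?_)
      rw [← NNReal.coe_le_coe, NNReal.coe_add, ← sub_le_iff_le_add']
      exact (le_abs_self _).trans ((hD i a a').trans (Real.le_coe_toNNReal D))

theorem exists_isLipschitzLimit_sub_const {v : Ultrafilter ι} (hdense : AsymptoticallyDense v Φ e)
    (hΦ : TotallyBounded (range Φ)) (hL : 0 ≤ L) {f : ∀ i, A i → ℝ≥0}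
    (hf : ∀ i a a', dist (f i a) (f i a') ≤ L * dist (Φ (e i a)) (Φ (e i a'))) :
    ∃ (w : ∀ i, A i → ℝ≥0) (c : ι → ℝ≥0) (G : Z → ℝ≥0), (∀ i a, f i a = w i a + c i) ∧
      IsLipschitzLimit v Φ e L w G ∧ ((∃ C : ℝ, ∀ i a, (f i a : ℝ) ≤ C) → w = f) := by
  obtain ⟨D, hD⟩ := Metric.isBounded_iff.1 hΦ.isBounded
  obtain ⟨w, c, B, hw, hwB, hwf⟩ := exists_eq_add_const_of_dist_le fun i a a' ↦
    (hf i a a').trans (mul_le_mul_of_nonneg_left (hD (mem_range_self _) (mem_range_self _)) hL)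
  obtain ⟨G, -, hG⟩ := exists_isLipschitzLimit hdense hΦ (isCompact_Icc (a := 0) (b := B)) hL
    (fun i a ↦ ⟨zero_le, hwB i a⟩) fun i a a' ↦ by
      simpa only [hw, NNReal.dist_eq, NNReal.coe_add, add_sub_add_right_eq_sub] using hf i a a'
  exact ⟨w, c, G, hw, hG, hwf⟩

end LipschitzLimit

section Barycenter

variable {X E : Type*} [NormedAddCommGroup E]

section Compact

variable [TopologicalSpace X] [CompactSpace X] [MeasurableSpace X]

theorem compactSpace_probabilityMeasure [R1Space X] [BorelSpace X] :
    CompactSpace (ProbabilityMeasure X) := by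
  let : MeasurableSpace (SeparationQuotient X) := borel _
  have : BorelSpace (SeparationQuotient X) := ⟨rfl⟩
  have : CompactSpace (SeparationQuotient X) := Quotient.compactSpace
  obtain ⟨s, hs⟩ := (SeparationQuotient.surjective_mk (X := X)).hasRightInverse
  have hs_cont : Continuous s :=
    SeparationQuotient.isInducing_mk.continuous_iff.2 (continuous_id.congr fun q ↦ (hs q).symm)
  have hmk : Continuous (SeparationQuotient.mk : X → SeparationQuotient X) :=
    SeparationQuotient.continuous_mk
  have hsurj : Function.Surjective fun ν : ProbabilityMeasure (SeparationQuotient X) ↦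
      ν.map hs_cont.aemeasurable := by
    refine fun μ ↦ ⟨μ.map hmk.aemeasurable, ProbabilityMeasure.toMeasure_injective ?_⟩
    simp only [ProbabilityMeasure.toMeasure_map]
    rw [Measure.map_map hs_cont.measurable hmk.measurable]
    ext B hB
    rw [Measure.map_apply (hs_cont.comp hmk).measurable hB]
    congr 1 with x
    exact (SeparationQuotient.mk_eq_mk.1 (hs (SeparationQuotient.mk x))).mem_measurableSet_iff hB
  exact hsurj.compactSpace (ProbabilityMeasure.continuous_map hs_cont)

theorem integrable_of_continuous [OpensMeasurableSpace X] {φ : X → E} (hφ : Continuous φ)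
    (μ : Measure X) [IsFiniteMeasure μ] : Integrable φ μ :=
  hφ.integrable_of_hasCompactSupport (HasCompactSupport.of_compactSpace φ)

theorem isCompact_range_integral [R1Space X] [BorelSpace X] [NormedSpace ℝ E] [CompleteSpace E]
    {φ : X → E} (hφ : Continuous φ) :
    IsCompact (range fun μ : ProbabilityMeasure X ↦ ∫ x, φ x ∂(μ : Measure X)) := by
  have := compactSpace_probabilityMeasure (X := X)
  have hint (μ : ProbabilityMeasure X) := integrable_of_continuous hφ (μ : Measure X)
  have hbdd : TotallyBounded (range fun μ : ProbabilityMeasure X ↦ ∫ x, φ x ∂(μ : Measure X)) := by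
    refine (isCompact_range hφ).totallyBounded.convexHull.closure.subset
      (range_subset_iff.2 fun μ ↦ ?_)
    exact (convex_convexHull ℝ _).closure.integral_mem isClosed_closure
      (ae_of_all _ fun x ↦ subset_closure (subset_convexHull ℝ _ (mem_range_self x))) (hint μ)
  have hweak : Continuous fun μ : ProbabilityMeasure X ↦
      toWeakSpace ℝ E (∫ x, φ x ∂(μ : Measure X)) := by
    refine WeakBilin.continuous_of_continuous_eval _ fun y ↦ ?_
    have hy := ProbabilityMeasure.continuous_integral_continuousMap
      (⟨fun x ↦ y (φ x), y.continuous.comp hφ⟩ : C(X, ℝ))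
    exact hy.congr fun μ ↦ y.integral_comp_comm (hint μ)
  refine hbdd.isCompact_of_isClosed ?_
  -- The range is the preimage under `E → WeakSpace ℝ E` of a compact, hence closed, set.
  convert (isCompact_range hweak).isClosed.preimage (toWeakSpaceCLM ℝ E).continuous
  ext h
  simp

end Compact

variable [InnerProductSpace ℝ E] [CompleteSpace E] [MeasurableSpace X]

theorem exists_norm_sum_sq_le {μ : Measure X} [IsProbabilityMeasure μ]
    {ψ : X → E} (hψ : Integrable ψ μ) (h0 : ∫ x, ψ x ∂μ = 0) {D : ℝ} (hD : ∀ x, ‖ψ x‖ ≤ D)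
    (n : ℕ) : ∃ x : Fin n → X, ‖∑ i, ψ (x i)‖ ^ 2 ≤ n * D ^ 2 := by
  induction n with
  | zero => exact ⟨Fin.elim0, by simp⟩
  | succ n ih =>
    obtain ⟨x, hx⟩ := ih
    -- The inner product with the current sum has mean zero, so it is nonpositive at some point.
    obtain ⟨y, hy⟩ := exists_le_integral (hψ.const_inner (∑ i, ψ (x i)))
    rw [integral_inner hψ, h0, inner_zero_right] at hy
    refine ⟨Fin.snoc x y, ?_⟩
    simp only [Fin.sum_univ_castSucc, Fin.snoc_castSucc, Fin.snoc_last, norm_add_sq_real,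
      Nat.cast_succ]
    linarith [pow_le_pow_left₀ (norm_nonneg _) (hD y) 2]

theorem integral_empirical {φ : X → E} (hφ : StronglyMeasurable φ) {M : ℕ+} (x : Fin M → X) :
    ∫ y, φ y ∂(empirical x : Measure X) = ((M : ℕ) : ℝ)⁻¹ • ∑ i, φ (x i) := by
  simp only [empirical, ProbabilityMeasure.coe_mk]
  rw [integral_smul_measure,
    integral_finsetSum_measure fun i _ ↦ integrable_dirac' hφ enorm_lt_top]
  simp [integral_dirac' φ _ hφ]

theorem exists_norm_integral_empirical_sub_le {φ : X → E} (hφ : StronglyMeasurable φ) {C : ℝ}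
    (hC : ∀ x, ‖φ x‖ ≤ C) (μ : ProbabilityMeasure X) (M : ℕ+) :
    ∃ x : Fin M → X, ‖∫ y, φ y ∂(empirical x : Measure X) - ∫ y, φ y ∂(μ : Measure X)‖ ≤
      2 * C / √(M : ℕ) := by
  set b := ∫ y, φ y ∂(μ : Measure X) with hb
  have hint : Integrable φ (μ : Measure X) :=
    .of_bound hφ.aestronglyMeasurable C (ae_of_all _ hC)
  have hbC : ‖b‖ ≤ C := by
    simpa using norm_integral_le_of_norm_le_const (μ := (μ : Measure X)) (ae_of_all _ hC)
  have hC0 : 0 ≤ C := (norm_nonneg b).trans hbC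
  have hM : (0 : ℝ) < (M : ℕ) := Nat.cast_pos.2 M.pos
  obtain ⟨x, hx⟩ := exists_norm_sum_sq_le (ψ := fun y ↦ φ y - b) (hint.sub (integrable_const b))
    (by rw [integral_sub hint (integrable_const b)]; simp [hb])
    (fun y ↦ (norm_sub_le_of_le (hC y) hbC).trans_eq (two_mul C).symm) M
  have hmean : ∫ y, φ y ∂(empirical x : Measure X) - b =
      ((M : ℕ) : ℝ)⁻¹ • ∑ i, (φ (x i) - b) := by
    rw [integral_empirical hφ, Finset.sum_sub_distrib, smul_sub]
    simp [← Nat.cast_smul_eq_nsmul ℝ, inv_smul_smul₀ hM.ne']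
  have hsum : ‖∑ i, (φ (x i) - b)‖ ≤ √(M : ℕ) * (2 * C) := by
    refine le_of_sq_le_sq ?_ (by positivity)
    rw [mul_pow, Real.sq_sqrt hM.le]
    exact hx
  refine ⟨x, ?_⟩
  calc ‖∫ y, φ y ∂(empirical x : Measure X) - b‖
      = ‖∑ i, (φ (x i) - b)‖ / (M : ℕ) := by
        rw [hmean, norm_smul, norm_inv, Real.norm_natCast, inv_mul_eq_div]
    _ ≤ √(M : ℕ) * (2 * C) / (M : ℕ) := by gcongr
    _ = 2 * C / √(M : ℕ) := by
        rw [mul_comm, mul_div_assoc, Real.sqrt_div_self, ← div_eq_mul_inv]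

end Barycenter

section Embedding

variable {X : Type*} [TopologicalSpace X] [CompactSpace X] [MeasurableSpace X]
  {Hk : Type*} [NormedAddCommGroup Hk] [InnerProductSpace ℝ Hk] [CompleteSpace Hk]
  [RKHS ℝ Hk X ℝ]

theorem isCompact_range_kme [R1Space X] [BorelSpace X] (hk : Continuous (feature Hk : X → Hk)) :
    IsCompact (range (kme Hk : ProbabilityMeasure X → Hk)) :=
  isCompact_range_integral hk

theorem asymptoticallyDense_empirical [OpensMeasurableSpace X]
    (hk : Continuous (feature Hk : X → Hk)) {ι : Type*} {v : Filter ι} {N : ι → ℕ+}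
    (hN : Tendsto (fun i ↦ (N i : ℕ)) v atTop) :
    AsymptoticallyDense v (kme Hk) fun i (x : Fin (N i) → X) ↦ empirical x := by
  intro μ
  obtain ⟨C, hC⟩ := (isCompact_range hk).isBounded.exists_norm_le
  choose x hx using fun i ↦ exists_norm_integral_empirical_sub_le
    (hk.stronglyMeasurable_of_hasCompactSupport (HasCompactSupport.of_compactSpace _))
    (forall_mem_range.1 hC) μ (N i)
  have hrate : Tendsto (fun i ↦ 2 * C / √(N i : ℕ)) v (𝓝 0) :=
    (Real.tendsto_sqrt_atTop.comp (tendsto_natCast_atTop_atTop.comp hN)).const_div_atTop _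
  exact ⟨x, tendsto_iff_norm_sub_tendsto_zero.2 (squeeze_zero (fun _ ↦ norm_nonneg _) hx hrate)⟩

end Embedding

section Joint

variable {X : Type*} [MeasurableSpace X]
  {Hk : Type*} [NormedAddCommGroup Hk] [InnerProductSpace ℝ Hk] [CompleteSpace Hk]
  [RKHS ℝ Hk X ℝ] {H : Type*} [NormedAddCommGroup H] {U : Set H} {q : ℝ≥0∞}

variable (Hk U q) in
/-- The pair `(Π_k(μ), u)` in the `q`-product of `H_k` and `H`. The exponent `q = 2` gives the
distance `prodDist` of the dynamics, and `q = 1` the distance `γ_k(μ, ν) + ‖u - u'‖` of the stage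
costs. -/
noncomputable def jointEmbedding (z : ProbabilityMeasure X × U) : WithLp q (Hk × H) :=
  WithLp.toLp q (kme Hk z.1, (z.2 : H))

/-- A state `x ∈ X^M` and an input, seen as a point of `P(X) × U`. -/
noncomputable def empiricalPair {M : ℕ+} (a : (Fin M → X) × U) : ProbabilityMeasure X × U :=
  (empirical a.1, a.2)

theorem tendsto_jointEmbedding {ι : Type*} {v : Filter ι} {μ : ι → ProbabilityMeasure X}
    {u : ι → U} {μ₀ : ProbabilityMeasure X} {u₀ : U}
    (hμ : Tendsto (fun i ↦ kme Hk (μ i)) v (𝓝 (kme Hk μ₀))) (hu : Tendsto u v (𝓝 u₀)) :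
    Tendsto (fun i ↦ jointEmbedding Hk U q (μ i, u i)) v (𝓝 (jointEmbedding Hk U q (μ₀, u₀))) :=
  ((WithLp.prod_continuous_toLp q Hk H).tendsto _).comp
    (hμ.prodMk_nhds (continuous_subtype_val.tendsto _ |>.comp hu))

variable [TopologicalSpace X] [CompactSpace X]

theorem totallyBounded_range_jointEmbedding [R1Space X] [BorelSpace X]
    (hk : Continuous (feature Hk : X → Hk)) (hU : IsCompact U) :
    TotallyBounded (range (jointEmbedding Hk U q : ProbabilityMeasure X × U → _)) := by
  refine (((isCompact_range_kme hk).prod hU).image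
    (WithLp.prod_continuous_toLp q Hk H)).totallyBounded.subset (range_subset_iff.2 fun z ↦ ?_)
  exact mem_image_of_mem _ ⟨mem_range_self z.1, z.2.2⟩

theorem asymptoticallyDense_empiricalPair [Fact (1 ≤ q)] [OpensMeasurableSpace X]
    (hk : Continuous (feature Hk : X → Hk)) {ι : Type*} {v : Filter ι} {N : ι → ℕ+}
    (hN : Tendsto (fun i ↦ (N i : ℕ)) v atTop) :
    AsymptoticallyDense v (jointEmbedding Hk U q) fun i (a : (Fin (N i) → X) × U) ↦
      empiricalPair a := by
  rintro ⟨μ, u⟩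
  obtain ⟨x, hx⟩ := asymptoticallyDense_empirical hk hN μ
  exact ⟨fun i ↦ (x i, u), tendsto_jointEmbedding hx tendsto_const_nhds⟩

end Joint

section MeanFieldLimit

variable {X : Type*} [MeasurableSpace X]
  {Hk : Type*} [NormedAddCommGroup Hk] [InnerProductSpace ℝ Hk] [CompleteSpace Hk]
  [RKHS ℝ Hk X ℝ] {H : Type*} [NormedAddCommGroup H] {U : Set H}
  {f : ∀ M : ℕ+, (Fin M → X) → U → (Fin M → X)} {Lf : ℝ}
  {l : ∀ M : ℕ+, (Fin M → X) → U → ℝ} {Ll : ℝ}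
  {F : ProbabilityMeasure X → U → ProbabilityMeasure X} {linf : ProbabilityMeasure X → U → ℝ}

theorem dist_kme (μ ν : ProbabilityMeasure X) : dist (kme Hk μ) (kme Hk ν) = mmd Hk μ ν :=
  dist_eq_norm _ _

theorem dist_jointEmbedding_one (z z' : ProbabilityMeasure X × U) :
    dist (jointEmbedding Hk U 1 z) (jointEmbedding Hk U 1 z') =
      mmd Hk z.1 z'.1 + ‖(z.2 : H) - (z'.2 : H)‖ :=
  (WithLp.prod_dist_eq_of_L1 _ _).trans (congr_arg₂ _ (dist_eq_norm _ _) (dist_eq_norm _ _))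

theorem dist_jointEmbedding_two (z z' : ProbabilityMeasure X × U) :
    dist (jointEmbedding Hk U 2 z) (jointEmbedding Hk U 2 z') =
      prodDist Hk z.1 z'.1 (z.2 : H) (z'.2 : H) :=
  dist_eq_norm _ _

theorem isLimitDynamics_iff {N : ℕ → ℕ+} :
    IsLimitDynamics Hk U f Lf N F ↔
      IsLipschitzLimit atTop (jointEmbedding Hk U 2) (fun p ↦ empiricalPair (M := N p)) Lf
        (fun p a ↦ kme Hk (empirical (f (N p) a.1 a.2))) fun z ↦ kme Hk (F z.1 z.2) := by
  constructor
  · intro h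
    refine ⟨fun z z' ↦ ?_, fun ε hε ↦ ?_⟩
    · simpa only [dist_jointEmbedding_two, dist_kme] using h.lipschitz z.1 z'.1 z.2 z'.2
    · simpa only [dist_kme, empiricalPair, Prod.forall] using h.tendsto ε hε
  · intro h
    refine ⟨fun μ ν u u' ↦ ?_, fun ε hε ↦ ?_⟩
    · simpa only [dist_jointEmbedding_two, dist_kme] using h.lipschitz (μ, u) (ν, u')
    · simpa only [dist_kme, empiricalPair, Prod.forall] using h.tendsto ε hε

theorem isLimitCost_iff {N : ℕ → ℕ+} :
    IsLimitCost Hk U l Ll N linf ↔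
      IsLipschitzLimit atTop (jointEmbedding Hk U 1) (fun p ↦ empiricalPair (M := N p)) Ll
        (fun p a ↦ l (N p) a.1 a.2) fun z ↦ linf z.1 z.2 := by
  constructor
  · intro h
    refine ⟨fun z z' ↦ ?_, fun ε hε ↦ ?_⟩
    · simpa only [dist_jointEmbedding_one, Real.dist_eq] using h.lipschitz z.1 z'.1 z.2 z'.2
    · simpa only [Real.dist_eq, empiricalPair, Prod.forall] using h.tendsto ε hε
  · intro h
    refine ⟨fun μ ν u u' ↦ ?_, fun ε hε ↦ ?_⟩
    · simpa only [dist_jointEmbedding_one, Real.dist_eq] using h.lipschitz (μ, u) (ν, u')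
    · simpa only [Real.dist_eq, empiricalPair, Prod.forall] using h.tendsto ε hε

variable [TopologicalSpace X] [CompactSpace X]

theorem exists_isLimitDynamics_isLimitCost [R1Space X] [BorelSpace X]
    (hk : Continuous (feature Hk : X → Hk)) (hU : IsCompact U) (hLf : 0 ≤ Lf)
    (hf : ∀ (M : ℕ+) (x x' : Fin M → X) (u u' : U),
      mmd Hk (empirical (f M x u)) (empirical (f M x' u')) ≤
        Lf * prodDist Hk (empirical x) (empirical x') (u : H) (u' : H))
    (hLl : 0 ≤ Ll) {B : ℝ} (hB : ∀ (M : ℕ+) (x : Fin M → X) (u : U), |l M x u| ≤ B)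
    (hl : ∀ (M : ℕ+) (x x' : Fin M → X) (u u' : U),
      |l M x u - l M x' u'| ≤ Ll * (mmd Hk (empirical x) (empirical x') + ‖(u : H) - (u' : H)‖)) :
    ∃ (N : ℕ → ℕ+) (F : ProbabilityMeasure X → U → ProbabilityMeasure X)
      (linf : ProbabilityMeasure X → U → ℝ), StrictMono N ∧
        IsLimitDynamics Hk U f Lf N F ∧ IsLimitCost Hk U l Ll N linf := by
  have hN : Tendsto (fun p : ℕ ↦ (p.succPNat : ℕ)) (hyperfilter ℕ) atTop :=
    (tendsto_add_atTop_nat 1).mono_left Nat.hyperfilter_le_atTop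
  obtain ⟨G, hGK, hG⟩ := exists_isLipschitzLimit (v := hyperfilter ℕ)
    (g := fun p (a : (Fin p.succPNat → X) × U) ↦ kme Hk (empirical (f p.succPNat a.1 a.2)))
    (asymptoticallyDense_empiricalPair hk hN) (totallyBounded_range_jointEmbedding (q := 2) hk hU)
    (isCompact_range_kme hk) hLf (fun _ _ ↦ mem_range_self _)
    fun p a a' ↦ by
      rw [dist_jointEmbedding_two, dist_kme]
      exact hf _ a.1 a'.1 a.2 a'.2
  obtain ⟨linf, -, hlinf⟩ := exists_isLipschitzLimit (v := hyperfilter ℕ)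
    (g := fun p (a : (Fin p.succPNat → X) × U) ↦ l p.succPNat a.1 a.2)
    (asymptoticallyDense_empiricalPair hk hN) (totallyBounded_range_jointEmbedding (q := 1) hk hU)
    isCompact_Icc hLl (fun _ a ↦ abs_le.1 (hB _ a.1 a.2))
    fun p a a' ↦ by
      rw [dist_jointEmbedding_one]
      exact hl _ a.1 a'.1 a.2 a'.2
  choose F hF using hGK
  obtain rfl : (fun z ↦ kme Hk (F z)) = G := funext hF
  obtain ⟨m, hm, hGm, hlm⟩ :=
    exists_strictMono_isLipschitzLimit Nat.hyperfilter_le_atTop hG hlinf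
  exact ⟨fun j ↦ (m j).succPNat, fun μ u ↦ F (μ, u), fun μ u ↦ linf (μ, u),
    Nat.succPNat_strictMono.comp hm, isLimitDynamics_iff.2 hGm, isLimitCost_iff.2 hlm⟩

theorem relaxedDynamicProgramming_of_isLipschitzLimit [OpensMeasurableSpace X]
    (hk : Continuous (feature Hk : X → Hk)) {ι : Type*} {v : Filter ι} [NeBot v] {N : ι → ℕ+}
    (hN : Tendsto (fun i ↦ (N i : ℕ)) v atTop)
    (hF : IsLipschitzLimit v (jointEmbedding Hk U 2) (fun i ↦ empiricalPair (M := N i)) Lf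
      (fun i a ↦ kme Hk (empirical (f (N i) a.1 a.2))) fun z ↦ kme Hk (F z.1 z.2))
    (hl : IsLipschitzLimit v (jointEmbedding Hk U 1) (fun i ↦ empiricalPair (M := N i)) Ll
      (fun i a ↦ l (N i) a.1 a.2) fun z ↦ linf z.1 z.2)
    {V : ∀ i, (Fin (N i) → X) → ℝ≥0} {LV : ℝ} {Vinf : ProbabilityMeasure X → ℝ≥0}
    (hV : IsLipschitzLimit v (kme Hk) (fun i ↦ empirical (M := N i)) LV V Vinf)
    {κ : ∀ i, (Fin (N i) → X) → U} {Lκ : ℝ} {κinf : ProbabilityMeasure X → U}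
    (hκ : IsLipschitzLimit v (kme Hk) (fun i ↦ empirical (M := N i)) Lκ κ κinf) {α : ℝ}
    (hdp : ∀ i x, (V i (f (N i) x (κ i x)) : ℝ) + α * l (N i) x (κ i x) ≤ V i x)
    (μ : ProbabilityMeasure X) :
    (Vinf (F μ (κinf μ)) : ℝ) + α * linf μ (κinf μ) ≤ Vinf μ := by
  obtain ⟨x, hx⟩ := asymptoticallyDense_empirical hk hN μ
  have hu : Tendsto (fun i ↦ κ i (x i)) v (𝓝 (κinf μ)) := hκ.tendsto_apply hx
  have hnext : Tendsto (fun i ↦ kme Hk (empirical (f (N i) (x i) (κ i (x i))))) v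
      (𝓝 (kme Hk (F μ (κinf μ)))) :=
    hF.tendsto_apply (a := fun i ↦ (x i, κ i (x i))) (z := (μ, κinf μ))
      (tendsto_jointEmbedding hx hu)
  have hcost : Tendsto (fun i ↦ l (N i) (x i) (κ i (x i))) v (𝓝 (linf μ (κinf μ))) :=
    hl.tendsto_apply (a := fun i ↦ (x i, κ i (x i))) (z := (μ, κinf μ))
      (tendsto_jointEmbedding hx hu)
  exact le_of_tendsto_of_tendsto'
    ((NNReal.tendsto_coe.2 (hV.tendsto_apply hnext)).add (hcost.const_mul α))
    (NNReal.tendsto_coe.2 (hV.tendsto_apply hx)) fun i ↦ hdp i (x i)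

end MeanFieldLimit

section SpaceAssumption

variable {X : Type*} [PseudoMetricSpace X] [MeasurableSpace X]
  {Hk : Type*} [NormedAddCommGroup Hk] [InnerProductSpace ℝ Hk] [CompleteSpace Hk]
  [RKHS ℝ Hk X ℝ] {k : X → X → ℝ}

theorem SpaceAssumption.continuous_feature (hX : SpaceAssumption Hk k) :
    Continuous (feature Hk : X → Hk) :=
  Isometry.continuous <| Isometry.of_dist_eq fun x x' ↦
    (dist_eq_norm _ _).trans (hX.dist_eq x x').symm

end SpaceAssumption

end MeanField

open MeanField in
theorem theorem3_general {X : Type*} [TopologicalSpace X] [R1Space X] [CompactSpace X]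
    [MeasurableSpace X] [BorelSpace X]
    {Hk : Type*} [NormedAddCommGroup Hk] [InnerProductSpace ℝ Hk] [CompleteSpace Hk]
    [RKHS ℝ Hk X ℝ] {H : Type*} [NormedAddCommGroup H]
    (hk : Continuous (feature Hk : X → Hk)) (U : Set H) (hU : IsCompact U)
    (f : ∀ M : ℕ+, (Fin M → X) → U → (Fin M → X)) (Lf : ℝ) (hLf : 0 ≤ Lf)
    (hf : ∀ (M : ℕ+) (x x' : Fin M → X) (u u' : U),
      mmd Hk (empirical (f M x u)) (empirical (f M x' u')) ≤
        Lf * prodDist Hk (empirical x) (empirical x') (u : H) u')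
    (l : ∀ M : ℕ+, (Fin M → X) → U → ℝ) (Ll : ℝ) (hLl : 0 ≤ Ll)
    (hlB : ∃ B : ℝ, ∀ (M : ℕ+) (x : Fin M → X) (u : U), |l M x u| ≤ B)
    (hl : ∀ (M : ℕ+) (x x' : Fin M → X) (u u' : U),
      |l M x u - l M x' u'| ≤ Ll *
        (mmd Hk (empirical x) (empirical x') + ‖(u : H) - u'‖)) :
    (∃ (N : ℕ → ℕ+) (F : ProbabilityMeasure X → U → ProbabilityMeasure X)
      (linf : ProbabilityMeasure X → U → ℝ), StrictMono N ∧
        IsLimitDynamics Hk U f Lf N F ∧ IsLimitCost Hk U l Ll N linf) ∧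
    ∀ (N : ℕ → ℕ+) (F : ProbabilityMeasure X → U → ProbabilityMeasure X)
      (linf : ProbabilityMeasure X → U → ℝ), Tendsto (fun p ↦ (N p : ℕ)) atTop atTop →
      IsLimitDynamics Hk U f Lf N F → IsLimitCost Hk U l Ll N linf →
    ∀ (V : ∀ p, (Fin (N p) → X) → ℝ≥0) (LV : ℝ), 0 ≤ LV →
      (∀ (p : ℕ) (x x' : Fin (N p) → X), |(V p x : ℝ) - V p x'| ≤
        LV * mmd Hk (empirical x) (empirical x')) →
    ∀ (κ : ∀ p, (Fin (N p) → X) → U) (Lκ : ℝ), 0 ≤ Lκ →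
      (∀ (p : ℕ) (x x' : Fin (N p) → X), ‖(κ p x : H) - κ p x'‖ ≤
        Lκ * mmd Hk (empirical x) (empirical x')) →
    ∀ α : ℝ,
      (∀ (p : ℕ) (x : Fin (N p) → X),
        (V p x : ℝ) ≥ V p (f (N p) x (κ p x)) + α * l (N p) x (κ p x)) →
    ∃ (m : ℕ → ℕ) (Vinf : ProbabilityMeasure X → ℝ≥0) (κinf : ProbabilityMeasure X → U),
      StrictMono m ∧
      (∀ μ ν : ProbabilityMeasure X, |(Vinf μ : ℝ) - Vinf ν| ≤ LV * mmd Hk μ ν) ∧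
      (∀ μ ν : ProbabilityMeasure X, ‖(κinf μ : H) - κinf ν‖ ≤ Lκ * mmd Hk μ ν) ∧
      (∀ ε > 0, ∀ᶠ j in atTop, ∀ x : Fin (N (m j)) → X,
        ‖(κ (m j) x : H) - κinf (empirical x)‖ ≤ ε) ∧
      ((∃ B : ℝ, ∀ (p : ℕ) (x : Fin (N p) → X), (V p x : ℝ) ≤ B) →
        ∀ ε > 0, ∀ᶠ j in atTop, ∀ x : Fin (N (m j)) → X,
          |(V (m j) x : ℝ) - Vinf (empirical x)| ≤ ε) ∧
      (∀ μ : ProbabilityMeasure X,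
        (Vinf μ : ℝ) ≥ Vinf (F μ (κinf μ)) + α * linf μ (κinf μ)) := by
  obtain ⟨B, hB⟩ := hlB
  refine ⟨exists_isLimitDynamics_isLimitCost hk hU hLf hf hLl hB hl, ?_⟩
  intro N F linf hN hF hlinf V LV hLV hV κ Lκ hLκ hκ α hdp
  have hv := Nat.hyperfilter_le_atTop
  have hdense := asymptoticallyDense_empirical hk (hN.mono_left hv)
  have hbdd := (isCompact_range_kme hk).totallyBounded
  obtain ⟨W, c, Vinf, hVW, hW, hWV⟩ :=
    exists_isLipschitzLimit_sub_const hdense hbdd hLV (f := V)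
      (by simpa only [NNReal.dist_eq, dist_kme] using hV)
  obtain ⟨κinf, -, hκinf⟩ := exists_isLipschitzLimit (g := κ) hdense hbdd
    (isCompact_iff_isCompact_univ.1 hU) hLκ (fun _ _ ↦ Set.mem_univ _)
    (by simpa only [Subtype.dist_eq, dist_eq_norm, mmd] using hκ)
  obtain ⟨m, hm, hWm, hκm⟩ := exists_strictMono_isLipschitzLimit hv hW hκinf
  refine ⟨m, Vinf, κinf, hm, ?_, ?_, ?_, fun hVB ↦ ?_, ?_⟩
  · simpa only [NNReal.dist_eq, dist_kme] using hW.lipschitz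
  · simpa only [Subtype.dist_eq, dist_eq_norm, mmd] using hκinf.lipschitz
  · simpa only [Subtype.dist_eq, dist_eq_norm] using hκm.tendsto
  · simpa only [hWV hVB, NNReal.dist_eq] using hWm.tendsto
  · refine relaxedDynamicProgramming_of_isLipschitzLimit hk (hN.mono_left hv)
      ((isLimitDynamics_iff.1 hF).mono hv) ((isLimitCost_iff.1 hlinf).mono hv)
      hW hκinf fun p x ↦ ?_
    have := hdp p x
    simp only [hVW, NNReal.coe_add] at this
    linarith

theorem theorem3 {X : Type*} [Nonempty X] [PseudoMetricSpace X] [MeasurableSpace X] [BorelSpace X]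
    {Hk : Type*} [NormedAddCommGroup Hk] [InnerProductSpace ℝ Hk] [CompleteSpace Hk]
    [RKHS ℝ Hk X ℝ]
    {H : Type*} [NormedAddCommGroup H] [InnerProductSpace ℝ H] [CompleteSpace H]
    (k : X → X → ℝ) (hX : MeanField.SpaceAssumption Hk k)
    (U : Set H) (hUcompact : IsCompact U) (hUconvex : Convex ℝ U)
    (f : ∀ M : ℕ+, (Fin M → X) → U → (Fin M → X)) (Lf : ℝ) (hLf : 0 ≤ Lf)
    (hf : MeanField.SystemAssumption Hk U f Lf)
    (l : ∀ M : ℕ+, (Fin M → X) → U → ℝ) (Ll : ℝ) (hLl : 0 ≤ Ll)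
    (hl : MeanField.CostAssumption Hk U l Ll) :
    -- the mean field limits of the dynamics and of the stage cost exist along a subsequence
    (∃ (N : ℕ → ℕ+) (F : ProbabilityMeasure X → U → ProbabilityMeasure X)
      (linf : ProbabilityMeasure X → U → ℝ), StrictMono N ∧
        MeanField.IsLimitDynamics Hk U f Lf N F ∧ MeanField.IsLimitCost Hk U l Ll N linf) ∧
    -- relaxed dynamic programming passes to the limit, for any such limits
    ∀ (N : ℕ → ℕ+) (F : ProbabilityMeasure X → U → ProbabilityMeasure X)
      (linf : ProbabilityMeasure X → U → ℝ), StrictMono N →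
      MeanField.IsLimitDynamics Hk U f Lf N F → MeanField.IsLimitCost Hk U l Ll N linf →
    ∀ (V : ∀ M : ℕ+, (Fin M → X) → ℝ≥0) (LV : ℝ), 0 ≤ LV →
      (∀ (p : ℕ) (x : Fin (N p) → X) (σ : Equiv.Perm (Fin (N p))),
        V (N p) (x ∘ σ) = V (N p) x) →
      (∀ (p : ℕ) (x x' : Fin (N p) → X),
        |(V (N p) x : ℝ) - V (N p) x'| ≤
          LV * MeanField.mmd Hk (MeanField.empirical x) (MeanField.empirical x')) →
    ∀ (κ : ∀ M : ℕ+, (Fin M → X) → U) (Lκ : ℝ), 0 ≤ Lκ →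
      (∀ (p : ℕ) (x : Fin (N p) → X) (σ : Equiv.Perm (Fin (N p))),
        κ (N p) (x ∘ σ) = κ (N p) x) →
      (∀ (p : ℕ) (x x' : Fin (N p) → X),
        ‖(κ (N p) x : H) - κ (N p) x'‖ ≤
          Lκ * MeanField.mmd Hk (MeanField.empirical x) (MeanField.empirical x')) →
    ∀ α : ℝ, 0 < α → α ≤ 1 →
      (∀ (p : ℕ) (x : Fin (N p) → X),
        (V (N p) x : ℝ) ≥
          V (N p) (f (N p) x (κ (N p) x)) + α * l (N p) x (κ (N p) x)) →
    ∃ (m : ℕ → ℕ) (Vinf : ProbabilityMeasure X → ℝ≥0) (κinf : ProbabilityMeasure X → U),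
      StrictMono m ∧
      (∀ μ ν : ProbabilityMeasure X, |(Vinf μ : ℝ) - Vinf ν| ≤ LV * MeanField.mmd Hk μ ν) ∧
      (∀ μ ν : ProbabilityMeasure X,
        ‖(κinf μ : H) - κinf ν‖ ≤ Lκ * MeanField.mmd Hk μ ν) ∧
      -- `κinf` is the mean field limit of the feedbacks along the subsequence `N ∘ m`
      (∀ ε > 0, ∀ᶠ j in atTop, ∀ x : Fin (N (m j)) → X,
        ‖(κ (N (m j)) x : H) - κinf (MeanField.empirical x)‖ ≤ ε) ∧
      -- if the value functions are uniformly bounded, `Vinf` is their mean field limit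
      ((∃ B : ℝ, ∀ (p : ℕ) (x : Fin (N p) → X), (V (N p) x : ℝ) ≤ B) →
        ∀ ε > 0, ∀ᶠ j in atTop, ∀ x : Fin (N (m j)) → X,
          |(V (N (m j)) x : ℝ) - Vinf (MeanField.empirical x)| ≤ ε) ∧
      (∀ μ : ProbabilityMeasure X,
        (Vinf μ : ℝ) ≥ Vinf (F μ (κinf μ)) + α * linf μ (κinf μ)) := by
  have := hX.compact
  refine (theorem3_general hX.continuous_feature U hUcompact f Lf hLf hf.lipschitz l Ll hLl
    hl.bounded hl.lipschitz).imp_right ?_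
  intro h N F linf hN hF hlinf V LV hLV _ hV κ Lκ hLκ _ hκ α _ _
  exact h N F linf (StrictMono.tendsto_atTop (φ := fun p ↦ (N p : ℕ)) hN) hF hlinf
    (fun p ↦ V (N p)) LV hLV hV (fun p ↦ κ (N p)) Lκ hLκ hκ α
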